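/- Let $X$ be a compact metric space and let $G$ be a countably infinite discrete amenable group acting on $X$ by homeomorphisms. Let $\mu$ be a $G$-invariant Borel probability measure on $X$, and let $(F_n)_{n\in\mathbb N}$ be a Følner sequence of $G$, that is, each $F_n\subset G$ is finite and nonempty and $\lim_{n\to\infty}|gF_n\,\Delta\,F_n|/|F_n|=0$ for every $g\in G$. Let $h\in L^2(X,\mu)$ be complex-valued, and set $H(x,y)=|h(x)-h(y)|$ for $x,y\in X$, where $h$ is identified with any fixed representative defined on all of $X$. For each $n$ put $$\overline H_{F_n}(x,y)=\frac1{|F_n|}\sum_{g\in F_n}H(gx,gy),$$ and for $\varepsilon>0$ let $C(\overline H_{F_n},\varepsilon)$ be the least $m\in\mathbb N$ for which there exist $x_1,\dots,x_m\in X$ with $$\mu\Big(\bigcup_{i=1}^m\{y\in X:\overline H_{F_n}(x_i,y)<\varepsilon/2\}\Big)>1-\varepsilon .$$ We say that $\mu$ has bounded complexity with respect to $\{\overline H_{F_n}\}$ if for every $\varepsilon>0$ there is $M=M(\varepsilon)\in\mathbb N$ with $C(\overline H_{F_n},\varepsilon)\le M$ for all $n\in\mathbb N$. The function $h$ is called almost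 periodic if $\{h\circ g:g\in G\}$ is precompact (has compact closure) in $L^2(X,\mu)$, where $(h\circ g)(x)=h(gx)$. Then $h$ is almost periodic if and only if $\mu$ has bounded complexity with respect to $\{\overline H_{F_n}:n\in\mathbb N\}$. -/

import Mathlib

open MeasureTheory Filter Topology
open scoped Pointwise symmDiff

noncomputable section

/-- A Følner sequence of a (discrete) group `G`: nonempty finite sets `F n` such that
`|g F n ∆ F n| / |F n| → 0` for every `g`. -/
structure IsFolnerSequence {G : Type*} [Group G] (F : ℕ → Finset G) : Prop where
  nonempty : ∀ n, (F n).Nonempty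
  tendsto : ∀ g : G,
    Tendsto (fun n => (((g • (F n : Set G)) ∆ (F n : Set G)).ncard : ℝ) / ((F n).card : ℝ))
      atTop (𝓝 0)

/-- The averaged semimetric `w̄_E (x, y) = |E|⁻¹ ∑_{g ∈ E} w (g x, g y)`. -/
def averagedSemimetric {G X : Type*} [Group G] [MulAction G X]
    (w : X → X → ℝ) (E : Finset G) (x y : X) : ℝ :=
  (1 / (E.card : ℝ)) * ∑ g ∈ E, w (g • x) (g • y)

/-- The least number `m` of open `ρ`-balls of radius `ε / 2` (with centres in `X`) whose union has
`μ`-measure greater than `1 - ε`; it is `⊤` if no finite number of balls suffices. -/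
def complexityFunction {X : Type*} [MeasurableSpace X] (μ : Measure X)
    (ρ : X → X → ℝ) (ε : ℝ) : ℕ∞ :=
  ⨅ m ∈ {m : ℕ | ∃ x : Fin m → X, 1 - ε < μ.real (⋃ i, {y | ρ (x i) y < ε / 2})}, (m : ℕ∞)

/-- `μ` has bounded complexity with respect to the averages of `w` along `F`: for each `ε > 0` the
complexity functions at scale `ε` are bounded uniformly in `n`. -/
def HasBoundedComplexity {G X : Type*} [Group G] [MulAction G X] [MeasurableSpace X]
    (μ : Measure X) (F : ℕ → Finset G) (w : X → X → ℝ) : Prop :=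
  ∀ ε : ℝ, 0 < ε → ∃ M : ℕ, ∀ n : ℕ,
    complexityFunction μ (averagedSemimetric w (F n)) ε ≤ (M : ℕ∞)

/-- `f ∈ L²(μ)` is almost periodic: its orbit `{f ∘ g : g ∈ G}` is precompact in `L²(μ)`. -/
def IsAlmostPeriodic (G : Type*) {X : Type*} [Group G] [MulAction G X] [MeasurableSpace X]
    [MeasurableConstSMul G X] {μ : Measure X} [SMulInvariantMeasure G X μ]
    (f : Lp ℂ 2 μ) : Prop :=
  IsCompact (closure (Set.range fun g : G =>
    Lp.compMeasurePreserving (fun x : X => g • x) (measurePreserving_smul g μ) f))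

end

/-! Put `d g k = ‖h ∘ g - h ∘ k‖₁`; invariance of `μ` makes this a right-invariant pseudometric on
`G`. The translates of `h` are equimeasurable, hence uniformly square-integrable, so total
boundedness of the orbit is the same in `L¹` as in `L²`.

Almost periodic to bounded complexity (`exists_cover_of_orbitL1Dist`): a finite `L¹`-net of the
orbit is approximated by simple functions, whose joint level sets form a finite partition not
depending on `n`. Off a set of small measure, two points of one piece are close for the averaged
semimetric, by Markov's inequality.

Conversely, `M` balls covering most of `X` give a partition on which most translates `h ∘ g`, `g ∈ F
n`, are `L¹`-close to step functions with `M` values. Compactness in `ℂ^M` and the pigeonhole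
principle put a proportion `κ` of `F n`, independent of `n`, in one small `d`-ball
(`exists_orbitL1Dist_density`). Since `F n` is almost invariant, a large `d`-separated set in `G`
would yield too many disjoint subsets of `F n` of proportion `κ / 2`, so `G` is totally bounded for
`d` (`IsFolnerSequence.exists_finset_forall_lt`). -/

/-! ### Covering a group from density along a Følner sequence -/

/-- If every set of a Følner sequence has a proportion at least `κ` of its elements in some
`ε`-ball of a right-invariant pseudometric, then the group is covered by finitely many
`2ε`-balls. -/
theorem IsFolnerSequence.exists_finset_forall_lt {G : Type*} [Group G] {F : ℕ → Finset G}
    (hF : IsFolnerSequence F) {d : G → G → ℝ} (symm : ∀ g k, d g k = d k g)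
    (triangle : ∀ a b c, d a c ≤ d a b + d b c) (inv : ∀ g k a, d (g * a) (k * a) = d g k)
    {ε κ : ℝ} (hκ : 0 < κ)
    (H : ∀ n, ∃ g₀, κ * (F n).card ≤ ((F n).filter fun g => d g g₀ < ε).card) :
    ∃ T : Finset G, ∀ g, ∃ k ∈ T, d g k < 2 * ε := by
  classical
  by_contra! hT
  obtain ⟨s, -, hs⟩ := exists_seq_of_forall_finset_exists (fun _ : G => True)
    (fun k g => 2 * ε ≤ d g k) fun T _ => by
      obtain ⟨g, hg⟩ := hT T
      exact ⟨g, trivial, hg⟩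
  -- `N` disjoint subsets of `F n` of proportion `κ / 2` would have total proportion above 1.
  obtain ⟨N, hN⟩ := exists_nat_gt (2 / κ)
  have hev : ∀ᶠ n in atTop, ∀ i ∈ Finset.range N,
      (((s i • (F n : Set G)) ∆ (F n : Set G)).ncard : ℝ) / ((F n).card : ℝ) < κ / 2 :=
    (Filter.eventually_all_finset _).2 fun i _ =>
      (hF.tendsto (s i)).eventually_lt_const (by positivity)
  obtain ⟨n, hn⟩ := hev.exists
  obtain ⟨g₀, hg₀⟩ := H n
  have hcard : (0 : ℝ) < (F n).card := by exact_mod_cast (hF.nonempty n).card_pos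
  -- Pull the dense ball back by `s i`: almost invariance of `F n` costs at most `κ / 2`. A common
  -- `x` of `W i` and `W j` would give `d (s j) (s i) = d (s j * x) (s i * x) < 2 * ε`, against
  -- separation.
  let W : ℕ → Finset G := fun i => (F n).filter fun x => d (s i * x) g₀ < ε
  have hW : ∀ i ∈ Finset.range N, κ / 2 * (F n).card ≤ ((W i).card : ℝ) := by
    intro i hi
    have h1 : ((F n).filter fun g => d g g₀ < ε).card ≤
        (W i).card + ((s i • (F n : Set G)) ∆ (F n : Set G)).ncard := by
      have hfin : ((s i • (F n : Set G)) ∆ (F n : Set G)).Finite :=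
        ((F n).finite_toSet.smul_set.union (F n).finite_toSet).subset symmDiff_le_sup
      rw [Set.ncard_eq_toFinset_card _ hfin]
      calc _ ≤ ((W i).image (s i * ·) ∪ hfin.toFinset).card := by
            apply Finset.card_le_card
            intro g hg
            rw [Finset.mem_filter] at hg
            rw [Finset.mem_union]
            by_cases hgs : g ∈ s i • (F n : Set G)
            · left
              obtain ⟨x, hx, rfl⟩ := hgs
              exact Finset.mem_image.2 ⟨x, Finset.mem_filter.2 ⟨hx, hg.2⟩, rfl⟩
            · right
              rw [Set.Finite.mem_toFinset]
              exact Or.inr ⟨hg.1, hgs⟩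
        _ ≤ _ := (Finset.card_union_le _ _).trans (Nat.add_le_add_right Finset.card_image_le _)
    have h2 := hn i hi
    rw [div_lt_iff₀ hcard] at h2
    have h3 : (((F n).filter fun g => d g g₀ < ε).card : ℝ) ≤
        (W i).card + ((s i • (F n : Set G)) ∆ (F n : Set G)).ncard := by exact_mod_cast h1
    linarith
  have key : ∀ i j, i < j → ∀ x, x ∈ W i → x ∈ W j → False := by
    intro i j hij x hi hj
    have h1 := hs i j hij
    have h2 := (Finset.mem_filter.1 hi).2
    have h3 := (Finset.mem_filter.1 hj).2
    have h4 := triangle (s j * x) g₀ (s i * x)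
    rw [inv, symm g₀] at h4
    linarith
  have hdisj : (Finset.range N : Set ℕ).PairwiseDisjoint W := by
    intro i _ j _ hij
    rw [Function.onFun, Finset.disjoint_left]
    intro x hi hj
    rcases lt_or_gt_of_ne hij with h | h
    · exact key i j h x hi hj
    · exact key j i h x hj hi
  have hle : ∑ i ∈ Finset.range N, (W i).card ≤ (F n).card := by
    rw [← Finset.card_biUnion hdisj]
    exact Finset.card_le_card (Finset.biUnion_subset.2 fun i _ => Finset.filter_subset _ _)
  have hle' : ∑ i ∈ Finset.range N, ((W i).card : ℝ) ≤ (F n).card := by exact_mod_cast hle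
  have h5 := (Finset.sum_le_sum hW).trans hle'
  rw [Finset.sum_const, Finset.card_range, nsmul_eq_mul] at h5
  rw [div_lt_iff₀ hκ] at hN
  nlinarith

/-! ### The `L¹` pseudometric on the group -/

/-- The `L¹(μ)` distance between two translates `f ∘ g` and `f ∘ k`. -/
noncomputable def orbitL1Dist {G X : Type*} [Group G] [MulAction G X] [MeasurableSpace X]
    (μ : Measure X) (f : X → ℂ) (g k : G) : ℝ :=
  ∫ x, ‖f (g • x) - f (k • x)‖ ∂μ

theorem orbitL1Dist_comm {G X : Type*} [Group G] [MulAction G X] [MeasurableSpace X]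
    {μ : Measure X} {f : X → ℂ} (g k : G) : orbitL1Dist μ f g k = orbitL1Dist μ f k g := by
  simp only [orbitL1Dist, norm_sub_rev]

section orbitL1Dist

variable {G X : Type*} [Group G] [MulAction G X] [MeasurableSpace X] [MeasurableConstSMul G X]
  {μ : Measure X} [SMulInvariantMeasure G X μ] {f : X → ℂ}

theorem MeasureTheory.MemLp.comp_smul {p : ENNReal} (hf : MemLp f p μ) (g : G) :
    MemLp (fun x => f (g • x)) p μ :=
  hf.comp_measurePreserving (measurePreserving_smul g μ)

theorem MeasureTheory.Integrable.comp_smul' (hf : Integrable f μ) (g : G) :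
    Integrable (fun x => f (g • x)) μ :=
  (measurePreserving_smul g μ).integrable_comp_of_integrable hf

theorem integral_comp_smul (u : X → ℝ) (g : G) : ∫ x, u (g • x) ∂μ = ∫ x, u x ∂μ :=
  (measurePreserving_smul g μ).integral_comp (measurableEmbedding_const_smul g) u

theorem orbitL1Dist_triangle (hf : Integrable f μ) (a b c : G) :
    orbitL1Dist μ f a c ≤ orbitL1Dist μ f a b + orbitL1Dist μ f b c := by
  have hi : ∀ g k : G, Integrable (fun x => ‖f (g • x) - f (k • x)‖) μ := fun g k =>
    ((hf.comp_smul' g).sub (hf.comp_smul' k)).norm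
  unfold orbitL1Dist
  rw [← integral_add (hi a b) (hi b c)]
  exact integral_mono (hi a c) ((hi a b).add (hi b c)) fun x => norm_sub_le_norm_sub_add_norm_sub _ _ _

theorem orbitL1Dist_mul_right (g k a : G) :
    orbitL1Dist μ f (g * a) (k * a) = orbitL1Dist μ f g k := by
  simp only [orbitL1Dist, mul_smul]
  exact integral_comp_smul (μ := μ) (fun x => ‖f (g • x) - f (k • x)‖) a

end orbitL1Dist

/-! ### Pigeonhole in finite dimension -/

/-- Pigeonhole principle for bounded families of vectors: a fixed proportion of them is contained in
a small ball around one of them. -/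
theorem exists_card_filter_norm_sub_lt (V : Type*) [NormedAddCommGroup V] [ProperSpace V]
    (B : ℝ) {η : ℝ} (hη : 0 < η) :
    ∃ κ : ℝ, 0 < κ ∧ ∀ {α : Type*} (S : Finset α) (u : α → V), S.Nonempty →
      (∀ a ∈ S, ‖u a‖ ≤ B) →
      ∃ a₀ ∈ S, κ * S.card ≤ ((S.filter fun a => ‖u a - u a₀‖ < η).card : ℝ) := by
  classical
  obtain ⟨t, -, htf, ht⟩ := (isCompact_closedBall (0 : V) B).finite_cover_balls (half_pos hη)
  lift t to Finset V using htf
  have hκ : (0 : ℝ) < (t.card + 1 : ℝ)⁻¹ := by positivity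
  refine ⟨(t.card + 1 : ℝ)⁻¹, hκ, fun {α} S u hS hu => ?_⟩
  have hex : ∀ a, ∃ y, a ∈ S → y ∈ t ∧ ‖u a - y‖ < η / 2 := by
    intro a
    by_cases ha : a ∈ S
    · have := ht (mem_closedBall_zero_iff.2 (hu a ha))
      simp only [Set.mem_iUnion, Finset.mem_coe, mem_ball_iff_norm] at this
      obtain ⟨y, hy, hy'⟩ := this
      exact ⟨y, fun _ => ⟨hy, hy'⟩⟩
    · exact ⟨0, fun h => absurd h ha⟩
  choose φ hφ using hex
  have hScard : (0 : ℝ) < S.card := by exact_mod_cast hS.card_pos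
  have htne : t.Nonempty := hS.imp' φ fun a ha => (hφ a ha).1
  obtain ⟨y, -, hy⟩ := Finset.exists_le_card_fiber_of_nsmul_le_card_of_maps_to
    (fun a ha => (hφ a ha).1) htne
    (b := (t.card + 1 : ℝ)⁻¹ * S.card) (by
      rw [nsmul_eq_mul, ← mul_assoc]
      refine mul_le_of_le_one_left hScard.le ?_
      rw [← div_eq_mul_inv, div_le_one (by positivity)]
      linarith)
  have hpos : (0 : ℝ) < ((S.filter fun a => φ a = y).card : ℝ) := lt_of_lt_of_le (by positivity) hy
  obtain ⟨a₀, ha₀⟩ := Finset.card_pos.1 (Nat.cast_pos.1 hpos)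
  rw [Finset.mem_filter] at ha₀
  refine ⟨a₀, ha₀.1, hy.trans ?_⟩
  norm_cast
  refine Finset.card_le_card fun a ha => ?_
  rw [Finset.mem_filter] at ha ⊢
  refine ⟨ha.1, ?_⟩
  have h1 := (hφ a ha.1).2
  have h2 := (hφ a₀ ha₀.1).2
  rw [ha.2] at h1
  rw [ha₀.2, norm_sub_rev] at h2
  have h3 := norm_sub_le_norm_sub_add_norm_sub (u a) y (u a₀)
  linarith

/-! ### From ball coverings to density of close translates -/

section

variable {G X : Type*} [Group G] [MulAction G X] [MeasurableSpace X] [MeasurableConstSMul G X]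
  {μ : Measure X} [IsProbabilityMeasure μ] [SMulInvariantMeasure G X μ] {f : X → ℂ}

/-- Uniform integrability of the orbit, from `t ≤ T + t² / T`: by invariance the bound does not
depend on `g`. -/
theorem setIntegral_norm_comp_smul_le (hf : MemLp f 2 μ) (g : G) (S : Set X) {T : ℝ}
    (hT : 0 < T) :
    ∫ x in S, ‖f (g • x)‖ ∂μ ≤ T * μ.real S + (∫ x, ‖f x‖ ^ 2 ∂μ) / T := by
  have hi : Integrable (fun x => ‖f (g • x)‖) μ :=
    ((hf.comp_smul g).integrable one_le_two).norm
  have hi2 : Integrable (fun x => ‖f (g • x)‖ ^ 2 / T) μ :=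
    ((hf.comp_smul g).norm.integrable_sq).div_const T
  calc ∫ x in S, ‖f (g • x)‖ ∂μ ≤ ∫ x in S, (T + ‖f (g • x)‖ ^ 2 / T) ∂μ := by
        refine integral_mono hi.integrableOn ((integrable_const T).add hi2.integrableOn) fun x => ?_
        change ‖f (g • x)‖ ≤ T + ‖f (g • x)‖ ^ 2 / T
        have h1 : T + ‖f (g • x)‖ ^ 2 / T = (T ^ 2 + ‖f (g • x)‖ ^ 2) / T := by field_simp
        rw [h1, le_div_iff₀ hT]
        nlinarith [sq_nonneg (‖f (g • x)‖ - T), mul_nonneg hT.le (norm_nonneg (f (g • x)))]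
    _ = T * μ.real S + ∫ x in S, ‖f (g • x)‖ ^ 2 / T ∂μ := by
        rw [integral_add (integrable_const T) hi2.integrableOn, setIntegral_const, smul_eq_mul,
          mul_comm]
    _ ≤ T * μ.real S + ∫ x, ‖f (g • x)‖ ^ 2 / T ∂μ := by
        have := setIntegral_le_integral (s := S) hi2 (ae_of_all _ fun x => by positivity)
        linarith
    _ = _ := by
        rw [integral_div, integral_comp_smul (fun x => ‖f x‖ ^ 2)]

/-- Compares both translates with step functions of values `a i`, `b i` on `A i`; the last bracket
pays for the uncovered part. -/
theorem orbitL1Dist_le_of_partition (hf : Integrable f μ) {ι : Type*} [Fintype ι] {A : ι → Set X}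
    (hA : ∀ i, MeasurableSet (A i)) (hd : Pairwise (Function.onFun Disjoint A)) (g k : G) (a b : ι → ℂ) :
    orbitL1Dist μ f g k ≤ ∑ i, ∫ x in A i, ‖a i - f (g • x)‖ ∂μ
      + ∑ i, ∫ x in A i, ‖b i - f (k • x)‖ ∂μ + ∑ i, μ.real (A i) * ‖a i - b i‖
      + (∫ x in (⋃ i, A i)ᶜ, ‖f (g • x)‖ ∂μ + ∫ x in (⋃ i, A i)ᶜ, ‖f (k • x)‖ ∂μ) := by
  have hi : Integrable (fun x => ‖f (g • x) - f (k • x)‖) μ :=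
    ((hf.comp_smul' g).sub (hf.comp_smul' k)).norm
  have hc : ∀ (c : ℂ) (l : G), Integrable (fun x => ‖c - f (l • x)‖) μ := fun c l =>
    ((integrable_const c).sub (hf.comp_smul' l)).norm
  unfold orbitL1Dist
  rw [← integral_add_compl (MeasurableSet.iUnion hA) hi]
  refine add_le_add ?_ ?_
  · rw [integral_iUnion_fintype hA hd fun i => hi.integrableOn, ← Finset.sum_add_distrib,
      ← Finset.sum_add_distrib]
    refine Finset.sum_le_sum fun i _ => ?_
    have h1 : μ.real (A i) * ‖a i - b i‖ = ∫ x in A i, ‖a i - b i‖ ∂μ := by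
      rw [setIntegral_const, smul_eq_mul]
    have h3 : IntegrableOn (fun x => ‖a i - f (g • x)‖ + ‖b i - f (k • x)‖) (A i) μ :=
      ((hc _ g).add (hc _ k)).integrableOn
    rw [h1, ← integral_add (hc _ g).integrableOn (hc _ k).integrableOn,
      ← integral_add h3 (integrable_const _)]
    refine integral_mono hi.integrableOn (h3.add (integrable_const _)) fun x => ?_
    change ‖f (g • x) - f (k • x)‖ ≤ ‖a i - f (g • x)‖ + ‖b i - f (k • x)‖ + ‖a i - b i‖
    have h2 : f (g • x) - f (k • x)
        = -(a i - f (g • x)) + (b i - f (k • x)) + (a i - b i) := by ring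
    rw [h2]
    refine (norm_add₃_le).trans ?_
    rw [norm_neg]
  · rw [← integral_add (hf.comp_smul' g).norm.integrableOn (hf.comp_smul' k).norm.integrableOn]
    exact integral_mono hi.integrableOn
      ((hf.comp_smul' g).norm.integrableOn.add (hf.comp_smul' k).norm.integrableOn)
      fun x => norm_sub_le _ _

/-- If most of the space is covered by `M` balls for the average of `‖f (g x) - f (g y)‖` over
`g ∈ E`, then a proportion of `E` depending only on `M` lies in one `ε`-ball for the `L¹` distance
of the translates of `f`. -/
theorem exists_orbitL1Dist_density (hm : Measurable f) (hf : MemLp f 2 μ) {ε : ℝ} (hε : 0 < ε) :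
    ∃ δ : ℝ, 0 < δ ∧ ∀ M : ℕ, ∃ κ : ℝ, 0 < κ ∧ ∀ E : Finset G, E.Nonempty →
      ∀ c : Fin M → G → ℂ,
      1 - δ < μ.real (⋃ i, {y | 1 / (E.card : ℝ) * ∑ g ∈ E, ‖c i g - f (g • y)‖ < δ / 2}) →
      ∃ g₀, κ * E.card ≤ ((E.filter fun g => orbitL1Dist μ f g g₀ < ε).card : ℝ) := by
  classical
  have hint : Integrable f μ := hf.integrable one_le_two
  set L := ∫ x, ‖f x‖ ^ 2 ∂μ with hL
  have hL0 : 0 ≤ L := integral_nonneg fun x => by positivity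
  -- `T` and `δ` make `L / T` and `T * δ` at most `ε / 8`, so each translate has integral at most `ε
  -- / 4` on the uncovered set.
  set T := 8 * (L + 1) / ε with hT
  have hT0 : 0 < T := by positivity
  set δ := min 1 (min (ε / 8 / T) (ε / 16)) with hδ
  have hδ0 : 0 < δ := by positivity
  have hδ1 : δ ≤ 1 := min_le_left _ _
  have hδ2 : T * δ ≤ ε / 8 := by
    have : δ ≤ ε / 8 / T := (min_le_right _ _).trans (min_le_left _ _)
    rw [le_div_iff₀ hT0] at this
    linarith
  have hδ3 : δ ≤ ε / 16 := (min_le_right _ _).trans (min_le_right _ _)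
  have hLT : L / T ≤ ε / 8 := by
    rw [div_le_iff₀ hT0, hT]
    field_simp
    linarith
  refine ⟨δ, hδ0, fun M => ?_⟩
  set η := ε / (16 * (M + 1)) with hη
  have hη0 : 0 < η := by positivity
  set N := ∫ x, ‖f x‖ ∂μ with hN
  have hN0 : 0 ≤ N := integral_nonneg fun x => norm_nonneg _
  obtain ⟨κ, hκ, hpig⟩ := exists_card_filter_norm_sub_lt (Fin M → ℂ) (N + 1) hη0
  refine ⟨κ / 2, by positivity, fun E hE c hcov => ?_⟩
  have hEc : (0 : ℝ) < E.card := by exact_mod_cast hE.card_pos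
  set B : Fin M → Set X :=
    fun i => {y | 1 / (E.card : ℝ) * ∑ g ∈ E, ‖c i g - f (g • y)‖ < δ / 2} with hB
  have hBm : ∀ i, MeasurableSet (B i) := fun i =>
    measurableSet_lt (Measurable.const_mul (Finset.measurable_sum _ fun g _ =>
      (measurable_const.sub (hm.comp (measurable_const_smul g))).norm) _) measurable_const
  set A := disjointed B with hA
  have hAm : ∀ i, MeasurableSet (A i) := fun i =>
    disjointedRec (fun _ _ h => h.diff (hBm _)) (hBm i)
  have hAd : Pairwise (Function.onFun Disjoint A) := disjoint_disjointed B
  have hAU : ⋃ i, A i = ⋃ i, B i := iUnion_disjointed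
  have hAsum : ∑ i, μ.real (A i) ≤ 1 := by
    rw [← measureReal_iUnion_fintype hAd hAm]
    exact measureReal_le_one
  have hbad : μ.real (⋃ i, A i)ᶜ ≤ δ := by
    rw [probReal_compl_eq_one_sub (MeasurableSet.iUnion hAm), hAU]
    linarith
  have hc : ∀ (c : ℂ) (l : G), Integrable (fun x => ‖c - f (l • x)‖) μ := fun c l =>
    ((integrable_const c).sub (hint.comp_smul' l)).norm
  -- `e g` is the error of the step approximation of `f ∘ g`. Its mean over `E` is at most `δ / 2`,
  -- so by Markov at least half of `E` has `e g ≤ δ`.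
  set e : G → ℝ := fun g => ∑ i, ∫ x in A i, ‖c i g - f (g • x)‖ ∂μ with he
  have he0 : ∀ g, 0 ≤ e g := fun g =>
    Finset.sum_nonneg fun i _ => integral_nonneg fun x => norm_nonneg _
  have hesum : ∑ g ∈ E, e g ≤ E.card * (δ / 2) := by
    rw [he, Finset.sum_comm]
    calc ∑ i, ∑ g ∈ E, ∫ x in A i, ‖c i g - f (g • x)‖ ∂μ
        ≤ ∑ i, μ.real (A i) * (E.card * (δ / 2)) := by
          refine Finset.sum_le_sum fun i _ => ?_
          rw [← integral_finsetSum _ fun g _ => (hc _ g).integrableOn, ← smul_eq_mul,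
            ← setIntegral_const]
          refine setIntegral_mono_on (integrable_finsetSum _ fun g _ => (hc _ g)).integrableOn
            (integrable_const _) (hAm i) fun x hx => ?_
          have h1 : x ∈ B i := disjointed_subset B i hx
          rw [hB, Set.mem_ofPred_eq, one_div, inv_mul_lt_iff₀ hEc] at h1
          exact h1.le
      _ ≤ 1 * (E.card * (δ / 2)) := by
          rw [← Finset.sum_mul]
          gcongr
      _ = _ := one_mul _
  set E' := E.filter fun g => e g ≤ δ with hE'
  have hE'c : (E.card : ℝ) / 2 ≤ E'.card := by
    have h1 : ((E.filter fun g => ¬ e g ≤ δ).card : ℝ) * δ ≤ ∑ g ∈ E, e g := by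
      rw [← nsmul_eq_mul]
      refine (Finset.card_nsmul_le_sum _ e δ fun g hg => ?_).trans
        (Finset.sum_le_sum_of_subset_of_nonneg (Finset.filter_subset _ _) fun g _ _ => he0 g)
      exact (not_le.1 (Finset.mem_filter.1 hg).2).le
    have h2 : (E'.card : ℝ) + (E.filter fun g => ¬ e g ≤ δ).card = E.card := by
      exact_mod_cast Finset.card_filter_add_card_filter_not (s := E) (fun g => e g ≤ δ)
    have h3 : ((E.filter fun g => ¬ e g ≤ δ).card : ℝ) * δ ≤ (E.card / 2) * δ := by linarith
    have h4 := le_of_mul_le_mul_right h3 hδ0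
    linarith
  have hE'ne : E'.Nonempty := by
    rw [← Finset.card_pos]
    have : (0 : ℝ) < E'.card := by linarith [half_pos hEc]
    exact_mod_cast this
  -- The values `c i g` themselves have no uniform bound; weighted by `μ (A i)` they are bounded by
  -- `N + 1`, and differences of weighted values are exactly the `L¹` contributions.
  set u : G → Fin M → ℂ := fun g i => (μ.real (A i) : ℂ) * c i g with hu
  have hub : ∀ g ∈ E', ‖u g‖ ≤ N + 1 := by
    intro g hg
    have hge : e g ≤ δ := (Finset.mem_filter.1 hg).2
    refine (pi_norm_le_iff_of_nonneg (by positivity)).2 fun i => ?_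
    have h1 : ‖u g i‖ = ∫ x in A i, ‖c i g‖ ∂μ := by
      rw [setIntegral_const, smul_eq_mul, hu, norm_mul, Complex.norm_real,
        Real.norm_of_nonneg measureReal_nonneg]
    have h2 : ∫ x in A i, ‖c i g‖ ∂μ
        ≤ ∫ x in A i, (‖c i g - f (g • x)‖ + ‖f (g • x)‖) ∂μ := by
      refine integral_mono (integrable_const _)
        ((hc _ g).add (hint.comp_smul' g).norm).integrableOn fun x => ?_
      simpa using norm_add_le (c i g - f (g • x)) (f (g • x))
    rw [integral_add (hc _ g).integrableOn (hint.comp_smul' g).norm.integrableOn] at h2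
    have h3 : ∫ x in A i, ‖f (g • x)‖ ∂μ ≤ N := by
      rw [hN, ← integral_comp_smul (fun x => ‖f x‖) g]
      exact setIntegral_le_integral (hint.comp_smul' g).norm (ae_of_all _ fun x => norm_nonneg _)
    have h4 : ∫ x in A i, ‖c i g - f (g • x)‖ ∂μ ≤ e g :=
      Finset.single_le_sum (f := fun i => ∫ x in A i, ‖c i g - f (g • x)‖ ∂μ)
        (fun i _ => integral_nonneg fun x => norm_nonneg _) (Finset.mem_univ i)
    linarith
  obtain ⟨g₀, hg₀, hcard⟩ := hpig E' u hE'ne hub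
  refine ⟨g₀, ?_⟩
  calc κ / 2 * E.card = κ * (E.card / 2) := by ring
    _ ≤ κ * E'.card := by gcongr
    _ ≤ _ := hcard
    _ ≤ _ := by
      norm_cast
      refine Finset.card_le_card fun g hg => ?_
      rw [Finset.mem_filter] at hg
      have hgE := Finset.mem_filter.1 hg.1
      refine Finset.mem_filter.2 ⟨hgE.1, ?_⟩
      refine (orbitL1Dist_le_of_partition hint hAm hAd g g₀ (c · g) (c · g₀)).trans_lt ?_
      have h1 : ∑ i, ∫ x in A i, ‖c i g - f (g • x)‖ ∂μ ≤ δ := hgE.2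
      have h2 : ∑ i, ∫ x in A i, ‖c i g₀ - f (g₀ • x)‖ ∂μ ≤ δ := (Finset.mem_filter.1 hg₀).2
      have h3 : ∑ i, μ.real (A i) * ‖c i g - c i g₀‖ ≤ M * η := by
        have : ∀ i ∈ Finset.univ, μ.real (A i) * ‖c i g - c i g₀‖ ≤ η := by
          intro i _
          have h5 : μ.real (A i) * ‖c i g - c i g₀‖ = ‖(u g - u g₀) i‖ := by
            rw [Pi.sub_apply, hu, ← mul_sub, norm_mul, Complex.norm_real,
              Real.norm_of_nonneg measureReal_nonneg]
          rw [h5]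
          exact (norm_le_pi_norm _ i).trans hg.2.le
        simpa using Finset.sum_le_card_nsmul _ _ _ this
      have h4 : M * η ≤ ε / 16 := by
        rw [hη]
        field_simp
        linarith
      have h5 : ∀ l : G, ∫ x in (⋃ i, A i)ᶜ, ‖f (l • x)‖ ∂μ ≤ ε / 4 := fun l => by
        have h6 := setIntegral_norm_comp_smul_le hf l (⋃ i, A i)ᶜ hT0
        have h7 := mul_le_mul_of_nonneg_left hbad hT0.le
        linarith
      have h6 := h5 g
      have h7 := h5 g₀
      linarith

end

/-! ### Comparing `L¹` and `L²` on the orbit -/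

/-- If both norms are at most `T`, then `‖a - b‖ ≤ 2 * T`; otherwise the larger norm exceeds `T` and
four times its square suffices. -/
theorem sq_norm_sub_le_truncation (a b : ℂ) {T : ℝ} (hT : 0 ≤ T) :
    ‖a - b‖ ^ 2 ≤ 2 * T * ‖a - b‖
      + 4 * ({z : ℂ | T < ‖z‖}.indicator (fun z => ‖z‖ ^ 2) a
        + {z : ℂ | T < ‖z‖}.indicator (fun z => ‖z‖ ^ 2) b) := by
  have h := norm_sub_le a b
  have ha := norm_nonneg a
  have hb := norm_nonneg b
  have hab := norm_nonneg (a - b)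
  have hp := mul_nonneg hT hab
  by_cases h1 : T < ‖a‖ <;> by_cases h2 : T < ‖b‖ <;>
    simp only [Set.indicator, Set.mem_ofPred_eq, h1, h2, if_true, if_false]
  · nlinarith [sq_nonneg (‖a‖ - ‖b‖)]
  · nlinarith
  · nlinarith
  · nlinarith

theorem MeasureTheory.MemLp.exists_integral_indicator_sq_lt {X : Type*} [MeasurableSpace X]
    {μ : Measure X} {f : X → ℂ} (hm : Measurable f) (hf : MemLp f 2 μ) {ε : ℝ} (hε : 0 < ε) :
    ∃ T : ℝ, 0 < T ∧
      ∫ x, {z : ℂ | T < ‖z‖}.indicator (fun z => ‖z‖ ^ 2) (f x) ∂μ < ε := by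
  have hlim : Tendsto (fun n : ℕ => ∫ x, {z : ℂ | (n : ℝ) < ‖z‖}.indicator
      (fun z => ‖z‖ ^ 2) (f x) ∂μ) atTop (𝓝 (∫ _, (0 : ℝ) ∂μ)) := by
    refine tendsto_integral_of_dominated_convergence (fun x => ‖f x‖ ^ 2) (fun n => ?_)
      hf.norm.integrable_sq (fun n => ae_of_all _ fun x => ?_) (ae_of_all _ fun x => ?_)
    · refine Measurable.aestronglyMeasurable ?_
      exact ((measurable_norm.pow_const 2).indicator
        (measurableSet_lt measurable_const measurable_norm)).comp hm
    · refine (norm_indicator_le_norm_self _ _).trans ?_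
      rw [Real.norm_of_nonneg (by positivity)]
    · refine tendsto_const_nhds.congr' ?_
      filter_upwards [eventually_ge_atTop ⌈‖f x‖⌉₊] with n hn
      rw [Set.indicator_of_notMem]
      exact not_lt.2 (Nat.ceil_le.1 hn)
  rw [integral_zero] at hlim
  obtain ⟨n, hn, hn'⟩ := ((hlim.eventually_lt_const hε).and (eventually_gt_atTop 0)).exists
  exact ⟨n, by exact_mod_cast hn', hn⟩

section

variable {G X : Type*} [Group G] [MulAction G X] [MeasurableSpace X] [MeasurableConstSMul G X]
  {μ : Measure X} [SMulInvariantMeasure G X μ]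

theorem dist_compMeasurePreserving_smul_sq {f : X → ℂ} (hf : MemLp f 2 μ) (g k : G) :
    dist (Lp.compMeasurePreserving (fun x : X => g • x) (measurePreserving_smul g μ) (hf.toLp f))
      (Lp.compMeasurePreserving (fun x : X => k • x) (measurePreserving_smul k μ) (hf.toLp f)) ^ 2
      = ∫ x, ‖f (g • x) - f (k • x)‖ ^ 2 ∂μ := by
  have hsub : MemLp (fun x => f (g • x) - f (k • x)) 2 μ := (hf.comp_smul g).sub (hf.comp_smul k)
  rw [Lp.toLp_compMeasurePreserving, Lp.toLp_compMeasurePreserving, dist_eq_norm, ← MemLp.toLp_sub,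
    Lp.norm_toLp]
  change (eLpNorm (fun x => f (g • x) - f (k • x)) 2 μ).toReal ^ 2 = _
  rw [hsub.eLpNorm_eq_integral_rpow_norm two_ne_zero ENNReal.ofNat_ne_top,
    ENNReal.toReal_ofReal (by positivity)]
  simp only [ENNReal.toReal_ofNat, Real.rpow_ofNat]
  rw [← Real.rpow_natCast, ← Real.rpow_mul (integral_nonneg fun x => by positivity)]
  norm_num

theorem isAlmostPeriodic_iff_totallyBounded (f : Lp ℂ 2 μ) :
    IsAlmostPeriodic G f ↔ TotallyBounded (Set.range fun g : G =>
      Lp.compMeasurePreserving (fun x : X => g • x) (measurePreserving_smul g μ) f) :=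
  ⟨fun h => h.totallyBounded.subset subset_closure,
    fun h => isCompact_iff_totallyBounded_isComplete.2 ⟨h.closure, isClosed_closure.isComplete⟩⟩

end

section

variable {G X : Type*} [Group G] [MulAction G X] [MeasurableSpace X] [MeasurableConstSMul G X]
  {μ : Measure X} [IsProbabilityMeasure μ] [SMulInvariantMeasure G X μ] {f : X → ℂ}

/-- On the orbit of a function in `L²`, a small `L¹` distance forces a small `L²` distance. -/
theorem exists_integral_sq_lt_of_orbitL1Dist_lt (hm : Measurable f) (hf : MemLp f 2 μ) {ε : ℝ}
    (hε : 0 < ε) :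
    ∃ δ : ℝ, 0 < δ ∧ ∀ g k : G, orbitL1Dist μ f g k < δ →
      ∫ x, ‖f (g • x) - f (k • x)‖ ^ 2 ∂μ < ε := by
  obtain ⟨T, hT, hlt⟩ := hf.exists_integral_indicator_sq_lt hm (show 0 < ε / 16 by positivity)
  -- The truncated part contributes less than `2 * T * δ = ε / 2`, the two tails less than `4 * 2 *
  -- (ε / 16) = ε / 2`.
  refine ⟨ε / (4 * T), by positivity, fun g k hgk => ?_⟩
  set tail : X → ℝ := fun x => {z : ℂ | T < ‖z‖}.indicator (fun z => ‖z‖ ^ 2) (f x) with htail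
  have hint : Integrable f μ := hf.integrable one_le_two
  have htm : Measurable tail := ((measurable_norm.pow_const 2).indicator
    (measurableSet_lt measurable_const measurable_norm)).comp hm
  have hti : Integrable tail μ := by
    refine hf.norm.integrable_sq.mono htm.aestronglyMeasurable (ae_of_all _ fun x => ?_)
    refine (norm_indicator_le_norm_self _ _).trans le_rfl
  have htg : ∀ l : G, Integrable (fun x => tail (l • x)) μ := fun l =>
    (measurePreserving_smul l μ).integrable_comp_of_integrable hti
  have hd : Integrable (fun x => 2 * T * ‖f (g • x) - f (k • x)‖) μ :=
    ((hint.comp_smul' g).sub (hint.comp_smul' k)).norm.const_mul _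
  have hs : Integrable (fun x => 4 * (tail (g • x) + tail (k • x))) μ :=
    ((htg g).add (htg k)).const_mul 4
  have h1 : ∫ x, ‖f (g • x) - f (k • x)‖ ^ 2 ∂μ ≤
      ∫ x, (2 * T * ‖f (g • x) - f (k • x)‖ + 4 * (tail (g • x) + tail (k • x))) ∂μ :=
    integral_mono ((hf.comp_smul g).sub (hf.comp_smul k)).norm.integrable_sq (hd.add hs)
      fun x => sq_norm_sub_le_truncation _ _ hT.le
  rw [integral_add hd hs, integral_const_mul, integral_const_mul, integral_add (htg g) (htg k),
    integral_comp_smul tail, integral_comp_smul tail] at h1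
  unfold orbitL1Dist at hgk
  rw [lt_div_iff₀ (by positivity)] at hgk
  linarith

/-- The pointwise bound `t ≤ δ + t² / δ` replaces Cauchy–Schwarz at the cost of a factor 2. -/
theorem orbitL1Dist_le_of_integral_sq_le (hf : MemLp f 2 μ) {δ : ℝ} (hδ : 0 < δ) {g k : G}
    (h : ∫ x, ‖f (g • x) - f (k • x)‖ ^ 2 ∂μ ≤ δ ^ 2) : orbitL1Dist μ f g k ≤ 2 * δ := by
  have hint : Integrable f μ := hf.integrable one_le_two
  have h2 : Integrable (fun x => ‖f (g • x) - f (k • x)‖ ^ 2 / δ) μ :=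
    (((hf.comp_smul g).sub (hf.comp_smul k)).norm.integrable_sq).div_const δ
  have h1 : orbitL1Dist μ f g k ≤ ∫ x, (δ + ‖f (g • x) - f (k • x)‖ ^ 2 / δ) ∂μ := by
    refine integral_mono ((hint.comp_smul' g).sub (hint.comp_smul' k)).norm
      ((integrable_const δ).add h2) fun x => ?_
    change ‖f (g • x) - f (k • x)‖ ≤ δ + ‖f (g • x) - f (k • x)‖ ^ 2 / δ
    have h3 : δ + ‖f (g • x) - f (k • x)‖ ^ 2 / δ
        = (δ ^ 2 + ‖f (g • x) - f (k • x)‖ ^ 2) / δ := by field_simp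
    rw [h3, le_div_iff₀ hδ]
    nlinarith [sq_nonneg (‖f (g • x) - f (k • x)‖ - δ),
      mul_nonneg hδ.le (norm_nonneg (f (g • x) - f (k • x)))]
  rw [integral_add (integrable_const δ) h2, integral_const, probReal_univ, one_smul,
    integral_div] at h1
  have h4 : (∫ x, ‖f (g • x) - f (k • x)‖ ^ 2 ∂μ) / δ ≤ δ := by
    rw [div_le_iff₀ hδ, ← sq]
    exact h
  linarith

/-- A function in `L²` is almost periodic if its orbit is totally bounded for the `L¹` distance. -/
theorem isAlmostPeriodic_of_orbitL1Dist (hm : Measurable f) (hf : MemLp f 2 μ)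
    (H : ∀ ε : ℝ, 0 < ε → ∃ T : Finset G, ∀ g, ∃ k ∈ T, orbitL1Dist μ f g k < ε) :
    IsAlmostPeriodic G (hf.toLp f) := by
  rw [isAlmostPeriodic_iff_totallyBounded, Metric.totallyBounded_iff]
  intro ε hε
  obtain ⟨δ, hδ, hδ'⟩ := exists_integral_sq_lt_of_orbitL1Dist_lt (G := G) hm hf
    (show 0 < ε ^ 2 by positivity)
  obtain ⟨T, hT⟩ := H δ hδ
  refine ⟨_, T.finite_toSet.image fun g : G => Lp.compMeasurePreserving (fun x : X => g • x)
    (measurePreserving_smul g μ) (hf.toLp f), ?_⟩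
  rintro _ ⟨g, rfl⟩
  obtain ⟨k, hk, hgk⟩ := hT g
  refine Set.mem_iUnion₂.2 ⟨_, ⟨k, hk, rfl⟩, ?_⟩
  have h1 := hδ' g k hgk
  rw [← dist_compMeasurePreserving_smul_sq hf] at h1
  exact lt_of_pow_lt_pow_left₀ 2 hε.le h1

/-- The orbit of an almost periodic function is totally bounded for the `L¹` distance. -/
theorem IsAlmostPeriodic.exists_orbitL1Dist_le (hf : MemLp f 2 μ)
    (hap : IsAlmostPeriodic G (hf.toLp f)) {ε : ℝ} (hε : 0 < ε) :
    ∃ T : Finset G, ∀ g, ∃ k ∈ T, orbitL1Dist μ f g k ≤ ε := by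
  classical
  rw [isAlmostPeriodic_iff_totallyBounded] at hap
  obtain ⟨t, ht, htf, hcov⟩ := Metric.finite_approx_of_totallyBounded hap (ε / 2) (half_pos hε)
  refine ⟨htf.toFinset.image (Function.invFun fun g : G =>
    Lp.compMeasurePreserving (fun x : X => g • x) (measurePreserving_smul g μ) (hf.toLp f)),
    fun g => ?_⟩
  obtain ⟨a, ha, hga⟩ := Set.mem_iUnion₂.1 (hcov ⟨g, rfl⟩)
  refine ⟨_, Finset.mem_image_of_mem _ (htf.mem_toFinset.2 ha), ?_⟩
  rw [← Function.invFun_eq (ht ha), Metric.mem_ball] at hga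
  rw [← mul_div_cancel₀ ε two_ne_zero]
  refine (orbitL1Dist_le_of_integral_sq_le hf (half_pos hε) ?_).trans_eq (by ring)
  rw [← dist_compMeasurePreserving_smul_sq hf]
  exact pow_le_pow_left₀ dist_nonneg hga.le 2

end

/-! ### From a totally bounded orbit to uniform coverings -/

theorem MeasureTheory.Integrable.exists_simpleFunc_integral_norm_sub_le {X : Type*}
    [MeasurableSpace X] {μ : Measure X} {f : X → ℂ} (hf : Integrable f μ) {δ : ℝ} (hδ : 0 < δ) :
    ∃ φ : SimpleFunc X ℂ, Integrable φ μ ∧ ∫ x, ‖f x - φ x‖ ∂μ ≤ δ := by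
  obtain ⟨φ, hφ, hφi⟩ := (memLp_one_iff_integrable.2 hf).exists_simpleFunc_eLpNorm_sub_lt
    ENNReal.one_ne_top (ENNReal.ofReal_pos.2 hδ).ne'
  rw [memLp_one_iff_integrable] at hφi
  refine ⟨φ, hφi, ?_⟩
  change ∫ x, ‖(f - ⇑φ) x‖ ∂μ ≤ δ
  rw [integral_norm_eq_lintegral_enorm (hf.sub hφi).aestronglyMeasurable]
  rw [eLpNorm_one_eq_lintegral_enorm] at hφ
  exact ENNReal.toReal_le_of_le_ofReal hδ.le hφ.le

section

variable {G X : Type*} [Group G] [MulAction G X] [MeasurableSpace X] [MeasurableConstSMul G X]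
  {μ : Measure X} [IsProbabilityMeasure μ] [SMulInvariantMeasure G X μ] {f : X → ℂ}

/-- If the orbit of `f` is totally bounded in `L¹`, then most of the space is covered by a number
of balls for the averages of `‖f x - f y‖` over `E` which does not depend on `E`. -/
theorem exists_cover_of_orbitL1Dist (hf : Integrable f μ)
    (H : ∀ ε : ℝ, 0 < ε → ∃ T : Finset G, ∀ g, ∃ k ∈ T, orbitL1Dist μ f g k ≤ ε)
    {ε : ℝ} (hε : 0 < ε) :
    ∃ m : ℕ, ∀ E : Finset G, E.Nonempty → ∃ x : Fin m → X,
      1 - ε < μ.real (⋃ i, {y | averagedSemimetric (fun x y => ‖f x - f y‖) E (x i) y < ε / 2}) := by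
  classical
  -- Then `∫ D ≤ 2 * δ = ε² / 8`, and Markov at level `ε / 4` leaves a bad set of measure at most `ε
  -- / 2`.
  set δ := ε ^ 2 / 16 with hδ
  have hδ0 : 0 < δ := by positivity
  obtain ⟨T, hT⟩ := H δ hδ0
  choose p hpT hp using hT
  choose φ hφi hφ using fun k : G =>
    (hf.comp_smul' k).exists_simpleFunc_integral_norm_sub_le hδ0
  -- The fibres of `Φ` are the joint level sets; their number depends on `ε` and not on `E`.
  set Φ : X → T → ℂ := fun x k => φ k x with hΦ
  have hfin : (Set.range Φ).Finite := by
    refine (Set.Finite.pi' fun k : T => (φ k).finite_range).subset ?_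
    rintro _ ⟨x, rfl⟩ k
    exact ⟨x, rfl⟩
  have := hfin.fintype
  refine ⟨Fintype.card (Set.range Φ), fun E hE => ?_⟩
  have hEc : (0 : ℝ) < E.card := by exact_mod_cast hE.card_pos
  have hi : ∀ g, Integrable (fun x => ‖f (g • x) - φ (p g) x‖) μ := fun g =>
    ((hf.comp_smul' g).sub (hφi _)).norm
  have hle : ∀ g, ∫ x, ‖f (g • x) - φ (p g) x‖ ∂μ ≤ 2 * δ := by
    intro g
    have h1 : Integrable (fun x => ‖f (g • x) - f (p g • x)‖) μ :=
      ((hf.comp_smul' g).sub (hf.comp_smul' _)).norm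
    have h2 : Integrable (fun x => ‖f (p g • x) - φ (p g) x‖) μ :=
      ((hf.comp_smul' _).sub (hφi _)).norm
    have h3 := integral_mono (hi g) (h1.add h2) fun x =>
      norm_sub_le_norm_sub_add_norm_sub (f (g • x)) (f (p g • x)) (φ (p g) x)
    have h4 := hp g
    have h5 := hφ (p g)
    simp only [Pi.add_apply] at h3
    rw [integral_add h1 h2] at h3
    unfold orbitL1Dist at h4
    linarith
  set D : X → ℝ := fun x => 1 / (E.card : ℝ) * ∑ g ∈ E, ‖f (g • x) - φ (p g) x‖ with hD
  have hDi : Integrable D μ := (integrable_finsetSum _ fun g _ => hi g).const_mul _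
  have hDle : ∫ x, D x ∂μ ≤ 2 * δ := by
    rw [hD, integral_const_mul, integral_finsetSum _ fun g _ => hi g, one_div,
      inv_mul_le_iff₀ hEc, ← nsmul_eq_mul]
    exact Finset.sum_le_card_nsmul _ _ _ fun g _ => hle g
  have hmarkov := mul_meas_ge_le_integral_of_nonneg
    (ae_of_all μ fun x => show 0 ≤ D x by positivity) hDi (ε / 4)
  have hbad : μ.real {x | ε / 4 ≤ D x} < ε := by
    by_contra! h
    nlinarith
  have hgood : 1 - ε < μ.real {x | D x < ε / 4} := by
    have h1 : (1 : ℝ) ≤ μ.real {x | ε / 4 ≤ D x} + μ.real {x | D x < ε / 4} := by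
      rw [← probReal_univ (μ := μ)]
      refine (measureReal_mono fun x _ => ?_).trans (measureReal_union_le _ _)
      exact le_or_gt (ε / 4) (D x)
    linarith
  have hne : Nonempty X := nonempty_of_isProbabilityMeasure μ
  -- Each fibre meeting the good set gets a centre that is itself good; other fibres get an
  -- arbitrary point.
  have hz : ∀ q : T → ℂ, ∃ x, ∀ y, Φ y = q → D y < ε / 4 → Φ x = q ∧ D x < ε / 4 := by
    intro q
    by_cases h : ∃ y, Φ y = q ∧ D y < ε / 4
    · obtain ⟨x, hx⟩ := h
      exact ⟨x, fun _ _ _ => hx⟩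
    · exact ⟨Classical.arbitrary X, fun y h1 h2 => absurd ⟨y, h1, h2⟩ h⟩
  choose z hz using hz
  refine ⟨fun i => z ((Fintype.equivFin (Set.range Φ)).symm i), hgood.trans_le ?_⟩
  refine measureReal_mono fun y hy => Set.mem_iUnion.2 ⟨Fintype.equivFin _ ⟨Φ y, Set.mem_range_self y⟩, ?_⟩
  simp only [Equiv.symm_apply_apply]
  obtain ⟨hzΦ, hzD⟩ := hz (Φ y) y rfl hy
  have hsum : averagedSemimetric (fun x y => ‖f x - f y‖) E (z (Φ y)) y ≤ D (z (Φ y)) + D y := by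
    rw [hD, averagedSemimetric, ← mul_add, ← Finset.sum_add_distrib]
    refine mul_le_mul_of_nonneg_left (Finset.sum_le_sum fun g _ => ?_) (by positivity)
    have h1 : φ (p g) (z (Φ y)) = φ (p g) y := congrFun hzΦ ⟨p g, hpT g⟩
    rw [norm_sub_rev (f (g • y)), ← h1]
    exact norm_sub_le_norm_sub_add_norm_sub _ _ _
  have hy' : D y < ε / 4 := hy
  change averagedSemimetric (fun x y => ‖f x - f y‖) E (z (Φ y)) y < ε / 2
  linarith

end

/-! ### The equivalence -/

theorem exists_cover_of_complexityFunction_le {X : Type*} [MeasurableSpace X] {μ : Measure X}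
    [IsProbabilityMeasure μ] {ρ : X → X → ℝ} {ε : ℝ} {M : ℕ}
    (h : complexityFunction μ ρ ε ≤ (M : ℕ∞)) :
    ∃ x : Fin M → X, 1 - ε < μ.real (⋃ i, {y | ρ (x i) y < ε / 2}) := by
  obtain ⟨m, hm, x, hx⟩ : ∃ m ≤ M, ∃ x : Fin m → X,
      1 - ε < μ.real (⋃ i, {y | ρ (x i) y < ε / 2}) := by
    by_contra! hcon
    have h1 : ((M + 1 : ℕ) : ℕ∞) ≤ complexityFunction μ ρ ε := by
      refine le_iInf₂ fun m hm => ?_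
      obtain ⟨x, hx⟩ := hm
      by_contra hlt
      rw [Nat.cast_le, not_le, Nat.lt_succ_iff] at hlt
      exact (hcon m hlt x).not_gt hx
    have h2 : M + 1 ≤ M := by exact_mod_cast h1.trans h
    omega
  have hne : Nonempty X := nonempty_of_isProbabilityMeasure μ
  refine ⟨fun i => if hi : (i : ℕ) < m then x ⟨i, hi⟩ else Classical.arbitrary X,
    hx.trans_le (measureReal_mono ?_)⟩
  refine Set.iUnion_subset fun i => Set.subset_iUnion_of_subset (Fin.castLE hm i) ?_
  simp

theorem mainTheorem2 {G X : Type*} [Group G] [Countable G] [Infinite G]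
    [MetricSpace X] [CompactSpace X] [MeasurableSpace X] [BorelSpace X]
    [MulAction G X] [ContinuousConstSMul G X]
    (μ : Measure X) [IsProbabilityMeasure μ] [SMulInvariantMeasure G X μ]
    (F : ℕ → Finset G) (hF : IsFolnerSequence F)
    (h : X → ℂ) (hh : MemLp h 2 μ) :
    IsAlmostPeriodic G (hh.toLp h) ↔
      HasBoundedComplexity μ F (fun x y => ‖h x - h y‖) := by
  constructor
  · intro hap ε hε
    obtain ⟨m, hm⟩ := exists_cover_of_orbitL1Dist (hh.integrable one_le_two)
      (fun ε hε => hap.exists_orbitL1Dist_le hh hε) hε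
    exact ⟨m, fun n => iInf₂_le m (hm (F n) (hF.nonempty n))⟩
  · intro hbc
    obtain ⟨f, hfs, hhf⟩ := hh.aestronglyMeasurable
    have hfm : Measurable f := hfs.measurable
    have hf : MemLp f 2 μ := hh.ae_eq hhf
    have hfi : Integrable f μ := hf.integrable one_le_two
    rw [MemLp.toLp_congr hh hf hhf]
    refine isAlmostPeriodic_of_orbitL1Dist hfm hf fun ε hε => ?_
    obtain ⟨δ, hδ, hdens⟩ := exists_orbitL1Dist_density (G := G) hfm hf (half_pos hε)
    obtain ⟨M, hM⟩ := hbc δ hδ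
    obtain ⟨κ, hκ, hdens⟩ := hdens M
    obtain ⟨T, hT⟩ := hF.exists_finset_forall_lt (orbitL1Dist_comm (μ := μ) (f := f))
      (orbitL1Dist_triangle hfi) orbitL1Dist_mul_right hκ fun n => by
        obtain ⟨x, hx⟩ := exists_cover_of_complexityFunction_le (hM n)
        -- The centres may lie in the null set where `h` and `f` differ, so their values are kept
        -- from `h`. Only the variable `y` passes to `f`, almost everywhere for all `g` at once as
        -- `G` is countable.
        refine hdens (F n) (hF.nonempty n) (fun i g => h (g • x i)) ?_
        convert hx using 1
        refine measureReal_congr (eventuallyEq_set.2 ?_)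
        have hae : ∀ᵐ y ∂μ, ∀ g : G, h (g • y) = f (g • y) := ae_all_iff.2 fun g =>
          (measurePreserving_smul g μ).quasiMeasurePreserving.ae hhf
        filter_upwards [hae] with y hy
        simp [averagedSemimetric, hy]
    refine ⟨T, fun g => ?_⟩
    obtain ⟨k, hk, hgk⟩ := hT g
    exact ⟨k, hk, by linarith⟩
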